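/- Let $G=(V,E)$ be a finite, simple, connected $d$-regular graph with $d\ge 3$ that is not isomorphic to $K_4$, $K_5$ or $K_{3,3}$. Let $E'=\{(u,v):\{u,v\}\in E\}$ be its set of oriented edges. Consider two Markov chains on $E'$. The simple random walk on the edge space has transition matrix $P_e$: from $(u,v)$ it moves to each $(v,w)\in E'$ with probability $1/\deg(v)$. The non-backtracking random walk has transition matrix $P_{nb}$: from $(u,v)$ it moves to each $(v,w)\in E'$ with $w\neq u$ with probability $1/(\deg(v)-1)$. For a finite Markov chain with transition matrix $P$ and unique stationary distribution $\pi$, let $m_{ij}$ be the mean first passage time from state $i$ to state $j$. If the sum $\sum_{j\neq i} m_{ij}\pi_j$ is finite and does not depend on the initial state $i$, its value is Kemeny's constant $\mathscr K(P)$. Then Kemeny's constant is well defined for both chains, and the edge Kemeny's constant $\mathscr K_e(G)=\mathscr K(P_e)$ and the non-backtracking Kemeny's constant $\mathscr K_{nb}(G)=\mathscr K(P_{nb})$ satisfy \[ \mathscr K_e(G)>\mathscr K_{nb}(G). \] -/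

import Mathlib

open scoped ENNReal NNReal

namespace KemenyNB

noncomputable section

section MarkovChain

variable {α : Type*} [Fintype α] [DecidableEq α]

/-- `p` is a stationary distribution of the transition matrix `P`: a probability vector with
`p P = p`. -/
def IsStationary (P : Matrix α α ℝ) (p : α → ℝ) : Prop :=
  p ∈ stdSimplex ℝ α ∧ Matrix.vecMul p P = p

/-- Transition matrix of the chain restricted to steps that do not enter state `j`. The `(i, l)`
entry of its `k`-th power is the probability, starting from `i`, of being at `l` at time `k`
without having visited `j` at any of the times `1, …, k`. -/
def tabooMatrix (P : Matrix α α ℝ) (j : α) : Matrix α α ℝ :=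
  Matrix.of fun a b => if b = j then 0 else P a b

/-- Probability that the chain started at `i` visits `j` at time `k + 1` and at none of the times
`1, …, k`, i.e. the probability that the first passage time from `i` to `j` equals `k + 1`. -/
def firstPassageProb (P : Matrix α α ℝ) (i j : α) (k : ℕ) : ℝ :=
  (tabooMatrix P j ^ k * P) i j

/-- Mean first passage time from `i` to `j`: the expectation of the `{1, 2, …, ∞}`-valued first
passage time. The last summand is the contribution of the event that `j` is never reached. -/
def meanFirstPassageTime (P : Matrix α α ℝ) (i j : α) : ℝ≥0∞ :=
  (∑' k : ℕ, ((k : ℝ≥0∞) + 1) * ENNReal.ofReal (firstPassageProb P i j k))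
    + ⊤ * (1 - ∑' k : ℕ, ENNReal.ofReal (firstPassageProb P i j k))

/-- `K` is Kemeny's constant of the finite Markov chain with transition matrix `P`: the matrix is
stochastic, it has exactly one stationary distribution `p`, and for every initial state `i`
the sum of `m_{ij} p_j` over `j ≠ i` equals the (finite) number `K`. -/
def IsKemenyConstant (P : Matrix α α ℝ) (K : ℝ≥0) : Prop :=
  P ∈ Matrix.rowStochastic ℝ α ∧
    (∃! p : α → ℝ, IsStationary P p) ∧
    ∀ p : α → ℝ, IsStationary P p → ∀ i : α,
      ∑ j ∈ Finset.univ.erase i, meanFirstPassageTime P i j * ENNReal.ofReal (p j) = (K : ℝ≥0∞)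

end MarkovChain

section EdgeSpace

variable {V : Type*} [Fintype V] [DecidableEq V] (G : SimpleGraph V) [DecidableRel G.Adj]

/-- Startpoint incidence operator. The oriented edges of `G` are its darts. -/
def startIncidence : Matrix V G.Dart ℝ :=
  Matrix.of fun u e => if u = e.fst then 1 else 0

/-- Endpoint incidence operator. -/
def endIncidence : Matrix G.Dart V ℝ :=
  Matrix.of fun e w => if e.snd = w then 1 else 0

/-- Edge reversal operator. -/
def edgeReversal : Matrix G.Dart G.Dart ℝ :=
  Matrix.of fun e f => if e.snd = f.fst ∧ e.fst = f.snd then 1 else 0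

/-- Diagonal matrix whose entry at the oriented edge `u → v` is the degree of `v`. -/
def edgeDegree : Matrix G.Dart G.Dart ℝ :=
  Matrix.diagonal fun e => (G.degree e.snd : ℝ)

/-- Transition matrix of the simple random walk on the oriented edges of `G`. -/
def edgeTransition : Matrix G.Dart G.Dart ℝ :=
  (edgeDegree G)⁻¹ * (endIncidence G * startIncidence G)

/-- Transition matrix of the non-backtracking random walk on the oriented edges of `G`. -/
def nbTransition : Matrix G.Dart G.Dart ℝ :=
  (edgeDegree G - 1)⁻¹ * (endIncidence G * startIncidence G - edgeReversal G)

/-- `K` is the edge Kemeny's constant of `G`. -/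
def IsEdgeKemeny (K : ℝ≥0) : Prop :=
  IsKemenyConstant (edgeTransition G) K

/-- `K` is the non-backtracking Kemeny's constant of `G`. -/
def IsNonBacktrackingKemeny (K : ℝ≥0) : Prop :=
  IsKemenyConstant (nbTransition G) K

end EdgeSpace

end

end KemenyNB

namespace KemenyNB

set_option linter.unusedSectionVars false

/-! Write `n = |V|`, `A` for the adjacency matrix, `L = d - A` for the Laplacian, `Y` for its
pseudoinverse, `J` for an all-ones matrix. If a doubly stochastic `P` on `N` states has `(1 - P) Z =
1 - J / N` and all row sums of `Z` equal `c`, its Kemeny constant is `tr Z - c`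
(`exists_isKemenyConstant`).

Let `S`, `T` be the start and end incidence matrices, `R` the edge reversal and `B = T S`. Then `P_e
= B / d` and `P_nb = (B - R) / (d - 1)`, while `S T = A` and `S R T = d`. These identities turn the
lift `E = T Y S` into an explicit `Z` for each chain (`exists_isEdgeKemeny`,
`exists_isNonBacktrackingKemeny`). Both constants are affine in `tr Y`, and their difference has the
sign of `(d - 2) (2 d tr Y - n) - d`.

It remains to bound `tr Y`, the sum of `1/λ` over the nonzero Laplacian eigenvalues, from below.
Cauchy–Schwarz gives `tr Y ≥ (n - 1)² / (n d)`, which suffices except when `(d, n)` is `(3, 4)`,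
`(3, 5)`, `(4, 5)` or `(3, 6)`. The first and third force `K₄` and `K₅`, and the second is
impossible by parity. For `(3, 6)`, a sharper bound contains a multiple of `tr A³`, which is
positive since a triangle-free graph would be `K₃,₃`. -/

/-- The matrix all of whose entries are `1`. -/
def allOnes (m n : Type*) : Matrix m n ℝ := Matrix.of fun _ _ => 1

@[simp] lemma allOnes_apply {m n : Type*} (i : m) (j : n) : allOnes m n i j = 1 := rfl

/-! ### First passage times and Kemeny's constant from a generalized inverse. -/

section MarkovChain

variable {α : Type*} [Fintype α] [DecidableEq α]

omit [Fintype α] in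
lemma tabooMatrix_apply (P : Matrix α α ℝ) (j a b : α) :
    tabooMatrix P j a b = if b = j then 0 else P a b := rfl

/-- Probability that the chain started at `i` avoids `j` at the times `1, …, k`. -/
noncomputable def survivalProb (P : Matrix α α ℝ) (j : α) (k : ℕ) : α → ℝ :=
  (tabooMatrix P j ^ k).mulVec 1

lemma survivalProb_zero (P : Matrix α α ℝ) (j : α) : survivalProb P j 0 = 1 := by
  simp [survivalProb]

lemma tabooMatrix_pow_nonneg {P : Matrix α α ℝ} (hP : P ∈ Matrix.rowStochastic ℝ α) (j : α)
    (k : ℕ) (a b : α) : 0 ≤ (tabooMatrix P j ^ k) a b := by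
  induction k generalizing a b with
  | zero => rw [pow_zero, Matrix.one_apply]; split_ifs <;> norm_num
  | succ k ih =>
    rw [pow_succ, Matrix.mul_apply]
    refine Finset.sum_nonneg fun l _ => mul_nonneg (ih a l) ?_
    rw [tabooMatrix_apply]
    split_ifs
    · exact le_rfl
    · exact hP.1 l b

lemma survivalProb_nonneg {P : Matrix α α ℝ} (hP : P ∈ Matrix.rowStochastic ℝ α) (j : α)
    (k : ℕ) (i : α) : 0 ≤ survivalProb P j k i :=
  Finset.sum_nonneg fun l _ => mul_nonneg (tabooMatrix_pow_nonneg hP j k i l) zero_le_one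

lemma firstPassageProb_eq_sub {P : Matrix α α ℝ} (hP : P ∈ Matrix.rowStochastic ℝ α) (i j : α)
    (k : ℕ) :
    firstPassageProb P i j k = survivalProb P j k i - survivalProb P j (k + 1) i := by
  have h1 : (fun a => P a j) = 1 - (tabooMatrix P j).mulVec 1 := by
    funext a
    have hrow := Matrix.sum_row_of_mem_rowStochastic hP a
    have hQ : ∑ b, tabooMatrix P j a b + P a j = ∑ b, P a b := by
      rw [← Finset.sum_erase_add _ _ (Finset.mem_univ j), ← Finset.sum_erase_add _ (P a)
        (Finset.mem_univ j)]
      have : tabooMatrix P j a j = 0 := if_pos rfl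
      rw [this, add_zero]
      congr 1
      exact Finset.sum_congr rfl fun b hb => if_neg (Finset.ne_of_mem_erase hb)
    simp only [Pi.sub_apply, Pi.one_apply, Matrix.mulVec, dotProduct, mul_one]
    linarith
  have h2 : firstPassageProb P i j k = (tabooMatrix P j ^ k).mulVec (fun a => P a j) i := rfl
  rw [h2, h1, Matrix.mulVec_sub, Matrix.mulVec_mulVec, ← pow_succ]
  rfl

lemma firstPassageProb_nonneg {P : Matrix α α ℝ} (hP : P ∈ Matrix.rowStochastic ℝ α) (i j : α)
    (k : ℕ) : 0 ≤ firstPassageProb P i j k :=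
  Finset.sum_nonneg fun l _ => mul_nonneg (tabooMatrix_pow_nonneg hP j k i l) (hP.1 l j)

/-- A solution of the first step equations is nonnegative. -/
lemma nonneg_of_first_step {P : Matrix α α ℝ} (hP : P ∈ Matrix.rowStochastic ℝ α) (j : α)
    {m : α → ℝ} (hm : m = 1 + (tabooMatrix P j).mulVec m) (i : α) : 0 ≤ m i := by
  by_contra! hi
  -- At a minimizer with `m a < 0`, substochasticity of the taboo row gives `m a ≥ 1 + m a`.
  obtain ⟨a, -, ha⟩ := Finset.exists_min_image Finset.univ m ⟨i, Finset.mem_univ i⟩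
  have ha0 : m a < 0 := (ha i (Finset.mem_univ i)).trans_lt hi
  have hQ0 : ∀ b, 0 ≤ tabooMatrix P j a b := fun b => by
    simpa using tabooMatrix_pow_nonneg hP j 1 a b
  have hQ1 : ∑ b, tabooMatrix P j a b ≤ 1 := by
    rw [← Matrix.sum_row_of_mem_rowStochastic hP a]
    refine Finset.sum_le_sum fun b _ => ?_
    rw [tabooMatrix_apply]
    split_ifs
    · exact hP.1 a b
    · exact le_rfl
  have h1 : (∑ b, tabooMatrix P j a b) * m a ≤ ∑ b, tabooMatrix P j a b * m b := by
    rw [Finset.sum_mul]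
    exact Finset.sum_le_sum fun b hb => mul_le_mul_of_nonneg_left (ha b hb) (hQ0 b)
  have h2 : m a = 1 + ∑ b, tabooMatrix P j a b * m b := congrFun hm a
  nlinarith

lemma sum_survivalProb {P : Matrix α α ℝ} (j : α)
    {m : α → ℝ} (hm : m = 1 + (tabooMatrix P j).mulVec m) (n : ℕ) (i : α) :
    ∑ k ∈ Finset.range n, survivalProb P j k i = m i - (tabooMatrix P j ^ n).mulVec m i := by
  induction n with
  | zero => simp
  | succ n ih =>
    have h : (tabooMatrix P j ^ n).mulVec m
        = survivalProb P j n + (tabooMatrix P j ^ (n + 1)).mulVec m := by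
      conv_lhs => rw [hm]
      rw [Matrix.mulVec_add, Matrix.mulVec_mulVec, ← pow_succ]
      rfl
    have h' := congrFun h i
    rw [Pi.add_apply] at h'
    rw [Finset.sum_range_succ, ih, h']
    ring

/-- A solution of the first step equations is the sum of the survival probabilities. -/
lemma hasSum_survivalProb {P : Matrix α α ℝ} (hP : P ∈ Matrix.rowStochastic ℝ α) (j : α)
    {m : α → ℝ} (hm : m = 1 + (tabooMatrix P j).mulVec m) (i : α) :
    HasSum (fun k => survivalProb P j k i) (m i) := by
  have hm0 := nonneg_of_first_step hP j hm
  have hsum : Summable (fun k => survivalProb P j k i) := by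
    refine summable_of_sum_range_le (c := m i) (fun k => survivalProb_nonneg hP j k i) fun n => ?_
    rw [sum_survivalProb j hm]
    have : 0 ≤ (tabooMatrix P j ^ n).mulVec m i :=
      Finset.sum_nonneg fun l _ => mul_nonneg (tabooMatrix_pow_nonneg hP j n i l) (hm0 l)
    linarith
  rw [hasSum_iff_tendsto_nat_of_nonneg fun k => survivalProb_nonneg hP j k i]
  have h0 := hsum.tendsto_atTop_zero
  -- The remainder is at most a constant times the survival probability, the general term of a
  -- convergent series.
  have h1 : Filter.Tendsto (fun n => (tabooMatrix P j ^ n).mulVec m i) Filter.atTop (nhds 0) := by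
    refine squeeze_zero (g := fun n => survivalProb P j n i * ∑ l, m l)
      (fun n => Finset.sum_nonneg fun l _ =>
        mul_nonneg (tabooMatrix_pow_nonneg hP j n i l) (hm0 l)) (fun n => ?_)
      (by simpa using h0.mul_const (∑ l, m l))
    simp only [survivalProb, Matrix.mulVec, dotProduct, Pi.one_apply, mul_one, Finset.sum_mul]
    exact Finset.sum_le_sum fun l _ => mul_le_mul_of_nonneg_left
      (Finset.single_le_sum (fun b _ => hm0 b) (Finset.mem_univ l))
      (tabooMatrix_pow_nonneg hP j n i l)
  simp only [sum_survivalProb j hm]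
  simpa using h1.const_sub (m i)

/-- First passage probabilities are differences of consecutive survival probabilities, so the series
telescopes. The case `l = 0` says that `j` is reached almost surely. -/
lemma tsum_firstPassageProb_add {P : Matrix α α ℝ} (hP : P ∈ Matrix.rowStochastic ℝ α) (i j : α)
    (h0 : Filter.Tendsto (fun k => survivalProb P j k i) Filter.atTop (nhds 0)) (l : ℕ) :
    ∑' k, ENNReal.ofReal (firstPassageProb P i j (l + k))
      = ENNReal.ofReal (survivalProb P j l i) := by
  have h : HasSum (fun k => firstPassageProb P i j (l + k)) (survivalProb P j l i) := by
    rw [hasSum_iff_tendsto_nat_of_nonneg fun k => firstPassageProb_nonneg hP i j (l + k)]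
    have hs : ∀ n, ∑ k ∈ Finset.range n, firstPassageProb P i j (l + k)
        = survivalProb P j l i - survivalProb P j (n + l) i := by
      intro n
      simp only [firstPassageProb_eq_sub hP]
      have := Finset.sum_range_sub' (fun k => survivalProb P j (l + k) i) n
      simp only [add_zero] at this
      rw [add_comm n l, ← this]
      rfl
    simp only [hs]
    simpa using ((Filter.tendsto_add_atTop_iff_nat l).2 h0).const_sub (survivalProb P j l i)
  rw [← ENNReal.ofReal_tsum_of_nonneg (fun k => firstPassageProb_nonneg hP i j (l + k))
    h.summable, h.tsum_eq]

/-- A sum of tails. -/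
lemma tsum_natCast_add_one_mul (f : ℕ → ℝ≥0∞) :
    ∑' k : ℕ, ((k : ℝ≥0∞) + 1) * f k = ∑' l : ℕ, ∑' k : ℕ, f (l + k) := by
  -- Group the pairs `(l, k)` by `l + k = n`; each antidiagonal has `n + 1` elements.
  rw [← ENNReal.tsum_prod (f := fun l k => f (l + k)), ← Equiv.tsum_eq
    (Finset.HasAntidiagonal.sigmaAntidiagonalEquivProd (A := ℕ)) (fun p : ℕ × ℕ => f (p.1 + p.2)),
    ENNReal.tsum_sigma']
  refine tsum_congr fun n => ?_
  rw [tsum_fintype, Finset.sum_congr rfl (g := fun _ => f n)]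
  · simp
  · rintro ⟨⟨a, b⟩, hab⟩ -
    have : a + b = n := by simpa using hab
    simp [Finset.HasAntidiagonal.sigmaAntidiagonalEquivProd, this]

/-- The mean first passage times are the solution of the first step equations. -/
lemma meanFirstPassageTime_eq {P : Matrix α α ℝ} (hP : P ∈ Matrix.rowStochastic ℝ α) (j : α)
    {m : α → ℝ} (hm : m = 1 + (tabooMatrix P j).mulVec m) (i : α) :
    meanFirstPassageTime P i j = ENNReal.ofReal (m i) := by
  have hs := hasSum_survivalProb hP j hm i
  have h0 := hs.summable.tendsto_atTop_zero
  have h1 : ∑' k, ENNReal.ofReal (firstPassageProb P i j k) = 1 := by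
    have := tsum_firstPassageProb_add hP i j h0 0
    simpa [survivalProb_zero] using this
  rw [meanFirstPassageTime, h1, tsub_self, mul_zero, add_zero, tsum_natCast_add_one_mul]
  simp only [tsum_firstPassageProb_add hP i j h0]
  rw [← ENNReal.ofReal_tsum_of_nonneg (fun k => survivalProb_nonneg hP j k i) hs.summable,
    hs.tsum_eq]

/-- Kemeny's constant of a doubly stochastic matrix `P`, from a generalized inverse of `1 - P`. -/
theorem exists_isKemenyConstant [Nonempty α] {P Z : Matrix α α ℝ}
    (hP : P ∈ Matrix.rowStochastic ℝ α) (hcol : Matrix.vecMul 1 P = 1)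
    (hZ : (1 - P) * Z = 1 - (Fintype.card α : ℝ)⁻¹ • allOnes α α) {c : ℝ}
    (hc : ∀ i, ∑ j, Z i j = c) :
    ∃ K : ℝ≥0, IsKemenyConstant P K ∧ (K : ℝ) = Z.trace - c := by
  set N : ℝ := (Fintype.card α : ℝ) with hN
  have hN0 : 0 < N := by simp [hN, Fintype.card_pos]
  have hPZ : ∀ i j, (P * Z) i j = Z i j - (if i = j then 1 else 0) + N⁻¹ := by
    intro i j
    have := congrFun (congrFun hZ i) j
    simp only [sub_mul, one_mul, Matrix.sub_apply, Matrix.smul_apply, allOnes_apply,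
      smul_eq_mul, mul_one, Matrix.one_apply] at this
    linarith
  -- The candidate for `m_{ij}`, with diagonal value the mean return time `N`. The taboo matrix has
  -- zero column `j`, so the diagonal term never enters the right side of the first step equations.
  set m : α → α → ℝ := fun j i => N * (Z j j - Z i j) + if i = j then N else 0 with hmdef
  have hm : ∀ j, m j = 1 + (tabooMatrix P j).mulVec (m j) := by
    intro j
    funext i
    have hrow := Matrix.sum_row_of_mem_rowStochastic hP i
    have h1 : (tabooMatrix P j).mulVec (m j) i = ∑ l, P i l * (N * (Z j j - Z l j)) := by
      simp only [Matrix.mulVec, dotProduct]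
      refine Finset.sum_congr rfl fun l _ => ?_
      by_cases hl : l = j
      · simp [tabooMatrix_apply, hl]
      · simp [tabooMatrix_apply, hmdef, hl]
    have h2 : ∑ l, P i l * (N * (Z j j - Z l j)) = N * (Z j j - (P * Z) i j) := by
      rw [Matrix.mul_apply]
      calc _ = N * Z j j * ∑ l, P i l - N * ∑ l, P i l * Z l j := by
            rw [Finset.mul_sum, Finset.mul_sum, ← Finset.sum_sub_distrib]
            exact Finset.sum_congr rfl fun l _ => by ring
        _ = _ := by rw [hrow]; ring
    rw [Pi.add_apply, h1, h2, hPZ]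
    simp only [hmdef, Pi.one_apply]
    split_ifs <;> field_simp <;> ring
  have hstat : ∀ p : α → ℝ, IsStationary P p ↔ p = fun _ => N⁻¹ := by
    intro p
    constructor
    · rintro ⟨⟨-, hp1⟩, hp⟩
      -- Stationarity kills `p (1 - P) Z = p - p J / N`, which forces `p` to be uniform.
      have h : Matrix.vecMul p ((1 - P) * Z) = 0 := by
        rw [← Matrix.vecMul_vecMul, Matrix.vecMul_sub, Matrix.vecMul_one, hp, sub_self,
          Matrix.zero_vecMul]
      rw [hZ, Matrix.vecMul_sub, Matrix.vecMul_one, sub_eq_zero] at h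
      rw [h]
      funext j
      simp only [Matrix.vecMul, dotProduct, Matrix.smul_apply, allOnes_apply, smul_eq_mul,
        mul_one]
      rw [← Finset.sum_mul, hp1, one_mul]
    · rintro rfl
      refine ⟨⟨fun _ => by positivity, ?_⟩, ?_⟩
      · simp [← hN, hN0.ne']
      · have : (fun _ : α => N⁻¹) = N⁻¹ • (1 : α → ℝ) := by
          funext; simp
        rw [this, Matrix.smul_vecMul, hcol]
  have hsum : ∀ i, ∑ j ∈ Finset.univ.erase i, m j i * N⁻¹ = Z.trace - c := by
    intro i
    have h1 : ∀ j ∈ Finset.univ.erase i, m j i * N⁻¹ = Z j j - Z i j := by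
      intro j hj
      have hij : i ≠ j := (Finset.ne_of_mem_erase hj).symm
      simp only [hmdef, if_neg hij]
      field_simp
      ring
    rw [Finset.sum_congr rfl h1, Finset.sum_erase _ (by simp), Finset.sum_sub_distrib, hc]
    rfl
  have hm0 : ∀ i j, 0 ≤ m j i * N⁻¹ := fun i j =>
    mul_nonneg (nonneg_of_first_step hP j (hm j) i) (by positivity)
  have hK0 : 0 ≤ Z.trace - c := by
    obtain ⟨i⟩ := ‹Nonempty α›
    rw [← hsum i]
    exact Finset.sum_nonneg fun j _ => hm0 i j
  refine ⟨⟨Z.trace - c, hK0⟩, ⟨hP, ⟨_, (hstat _).2 rfl, fun p hp => (hstat p).1 hp⟩, ?_⟩, rfl⟩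
  intro p hp i
  rw [(hstat p).1 hp]
  calc _ = ∑ j ∈ Finset.univ.erase i, ENNReal.ofReal (m j i * N⁻¹) := by
        refine Finset.sum_congr rfl fun j _ => ?_
        rw [meanFirstPassageTime_eq hP j (hm j) i,
          ENNReal.ofReal_mul (nonneg_of_first_step hP j (hm j) i)]
    _ = ENNReal.ofReal (Z.trace - c) := by
        rw [← ENNReal.ofReal_sum_of_nonneg fun j _ => hm0 i j, hsum]
    _ = _ := by
        rw [ENNReal.ofReal, Real.toNNReal_of_nonneg hK0]
        rfl

end MarkovChain

section AllOnes

variable {l m n : Type*} [Fintype m] [DecidableEq m]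

omit [DecidableEq m] in
lemma mul_allOnes_of_sum_eq {M : Matrix l m ℝ} {c : ℝ} (h : ∀ i, ∑ j, M i j = c) :
    M * allOnes m n = c • allOnes l n := by
  ext i j
  simp [Matrix.mul_apply, h]

omit [DecidableEq m] in
lemma sum_eq_of_mul_allOnes {M : Matrix l m ℝ} {c : ℝ} (h : M * allOnes m m = c • allOnes l m)
    (i : l) (k : m) : ∑ j, M i j = c := by
  simpa [Matrix.mul_apply] using congrFun (congrFun h i) k

end AllOnes

/-! ### Incidence and reversal identities on oriented edges. -/

section Incidence

variable {V X : Type*} [Fintype V] [DecidableEq V] (G : SimpleGraph V) [DecidableRel G.Adj]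

omit [DecidableEq V] in
lemma sum_dart (f : V → V → ℝ) :
    ∑ e : G.Dart, f e.fst e.snd = ∑ u, ∑ w, if G.Adj u w then f u w else 0 := by
  rw [← Finset.sum_product', ← Finset.sum_filter]
  refine Finset.sum_bij' (fun e _ => e.toProd)
    (fun p hp => ⟨p, (Finset.mem_filter.1 hp).2⟩) ?_ ?_ ?_ ?_ ?_ <;> simp [SimpleGraph.Dart.adj]

lemma endIncidence_mul_apply (M : Matrix V X ℝ) (e : G.Dart) (x : X) :
    (endIncidence G * M) e x = M e.snd x := by
  simp [Matrix.mul_apply, endIncidence]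

lemma mul_startIncidence_apply (M : Matrix X V ℝ) (x : X) (e : G.Dart) :
    (M * startIncidence G) x e = M x e.fst := by
  simp [Matrix.mul_apply, startIncidence]

lemma edgeReversal_apply (e f : G.Dart) :
    edgeReversal G e f = if e.symm = f then 1 else 0 := by
  simp only [edgeReversal, Matrix.of_apply, SimpleGraph.Dart.ext_iff, Prod.ext_iff]
  rfl

lemma edgeReversal_mul_apply (M : Matrix G.Dart X ℝ) (e : G.Dart) (x : X) :
    (edgeReversal G * M) e x = M e.symm x := by
  simp [Matrix.mul_apply, edgeReversal_apply]

lemma edgeReversal_mul_self : edgeReversal G * edgeReversal G = 1 := by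
  ext e f
  rw [edgeReversal_mul_apply, edgeReversal_apply, SimpleGraph.Dart.symm_symm, Matrix.one_apply]

lemma trace_edgeReversal : (edgeReversal G).trace = 0 := by
  refine Finset.sum_eq_zero fun e _ => ?_
  rw [Matrix.diag_apply, edgeReversal_apply, if_neg e.symm_ne]

lemma startIncidence_mul_endIncidence :
    startIncidence G * endIncidence G = G.adjMatrix ℝ := by
  ext u w
  simp only [Matrix.mul_apply, startIncidence, endIncidence, Matrix.of_apply,
    SimpleGraph.adjMatrix_apply]
  rw [sum_dart G fun a b => (if u = a then (1 : ℝ) else 0) * if b = w then 1 else 0]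
  rw [Finset.sum_eq_single u, Finset.sum_eq_single w] <;> simp +contextual [eq_comm]

variable {G} {d : ℕ} (hreg : G.IsRegularOfDegree d)
include hreg

lemma sum_adj_of_isRegular (u : V) : (∑ w, if G.Adj u w then (1 : ℝ) else 0) = d := by
  rw [← SimpleGraph.degree_eq_sum_if_adj, hreg u]

lemma startIncidence_mul_edgeReversal_mul_endIncidence :
    startIncidence G * (edgeReversal G * endIncidence G) = (d : ℝ) • (1 : Matrix V V ℝ) := by
  ext u w
  rw [Matrix.mul_apply]
  simp only [edgeReversal_mul_apply, startIncidence, endIncidence, Matrix.of_apply]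
  change ∑ e : G.Dart, (if u = e.fst then (1 : ℝ) else 0) * (if e.fst = w then 1 else 0) = _
  rw [sum_dart G fun a b => (if u = a then (1 : ℝ) else 0) * if a = w then 1 else 0]
  rw [Finset.sum_eq_single u]
  · by_cases h : u = w <;> simp [h]
    simpa using sum_adj_of_isRegular hreg w
  · simp +contextual [eq_comm]
  · simp

lemma card_dart_of_isRegular : Fintype.card G.Dart = Fintype.card V * d := by
  rw [G.dart_card_eq_sum_degrees, Finset.sum_congr rfl fun v _ => hreg v]
  simp

omit hreg in
lemma endIncidence_mul_allOnes : endIncidence G * allOnes V X = allOnes G.Dart X := by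
  ext e x
  rw [endIncidence_mul_apply]
  rfl

omit hreg in
lemma allOnes_mul_startIncidence : allOnes X V * startIncidence G = allOnes X G.Dart := by
  ext e x
  rw [mul_startIncidence_apply]
  rfl

omit hreg in
lemma edgeReversal_mul_allOnes : edgeReversal G * allOnes G.Dart X = allOnes G.Dart X := by
  ext e x
  rw [edgeReversal_mul_apply]
  rfl

omit hreg in
lemma allOnes_mul_edgeReversal : allOnes X G.Dart * edgeReversal G = allOnes X G.Dart := by
  ext x e
  rw [Matrix.mul_apply, allOnes_apply, Finset.sum_eq_single e.symm] <;>
    simp +contextual [edgeReversal_apply, SimpleGraph.Dart.symm_involutive.eq_iff]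

lemma startIncidence_mul_allOnes :
    startIncidence G * allOnes G.Dart X = (d : ℝ) • allOnes V X := by
  rw [mul_allOnes_of_sum_eq]
  intro u
  rw [← sum_adj_of_isRegular hreg u]
  simp only [startIncidence, Matrix.of_apply]
  rw [sum_dart G fun a b => (if u = a then (1 : ℝ) else 0), Finset.sum_eq_single u] <;>
    simp +contextual [eq_comm]

lemma allOnes_mul_endIncidence :
    allOnes X G.Dart * endIncidence G = (d : ℝ) • allOnes X V := by
  ext x w
  rw [Matrix.mul_apply]
  simp only [endIncidence, Matrix.of_apply, allOnes_apply, one_mul]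
  rw [sum_dart G fun a b => (if b = w then (1 : ℝ) else 0), Finset.sum_comm,
    Finset.sum_eq_single w]
  · simpa [SimpleGraph.adj_comm] using sum_adj_of_isRegular hreg w
  · simp +contextual [eq_comm]
  · simp

end Incidence

/-! ### The pseudoinverse of the Laplacian and lower bounds for its trace. -/

section Laplacian

variable {V : Type*} [Fintype V] [DecidableEq V] (G : SimpleGraph V) [DecidableRel G.Adj]

lemma allOnes_mul_allOnes :
    allOnes V V * allOnes V V = (Fintype.card V : ℝ) • allOnes V V :=
  mul_allOnes_of_sum_eq fun _ => by simp

lemma lapMatrix_mul_allOnes : G.lapMatrix ℝ * allOnes V V = 0 := by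
  rw [mul_allOnes_of_sum_eq (c := 0), zero_smul]
  intro i
  simpa [Matrix.mulVec, dotProduct] using congrFun (G.lapMatrix_mulVec_const_eq_zero (R := ℝ)) i

lemma transpose_allOnes : (allOnes V V).transpose = allOnes V V := rfl

lemma allOnes_mul_lapMatrix : allOnes V V * G.lapMatrix ℝ = 0 := by
  have := congrArg Matrix.transpose (lapMatrix_mul_allOnes G)
  rwa [Matrix.transpose_mul, (G.isSymm_lapMatrix (R := ℝ)).eq, transpose_allOnes,
    Matrix.transpose_zero] at this

variable {G}

/-- The kernel is trivial: applying `J` shows that a kernel vector has sum zero, so `L` kills it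
too, and by connectedness it is constant. -/
lemma isUnit_lapMatrix_add_allOnes (hconn : G.Connected) :
    IsUnit (G.lapMatrix ℝ + (Fintype.card V : ℝ)⁻¹ • allOnes V V) := by
  have := hconn.nonempty
  have hn : (Fintype.card V : ℝ) ≠ 0 := by simp
  rw [← Matrix.mulVec_injective_iff_isUnit]
  refine (injective_iff_map_eq_zero
    (Matrix.mulVecLin (G.lapMatrix ℝ + (Fintype.card V : ℝ)⁻¹ • allOnes V V))).2 fun x hx => ?_
  rw [Matrix.mulVecLin_apply] at hx
  have hJ : (allOnes V V).mulVec x = 0 := by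
    have h : allOnes V V * (G.lapMatrix ℝ + (Fintype.card V : ℝ)⁻¹ • allOnes V V)
        = allOnes V V := by
      rw [mul_add, allOnes_mul_lapMatrix, Matrix.mul_smul, allOnes_mul_allOnes,
        inv_smul_smul₀ hn, zero_add]
    rw [← h, ← Matrix.mulVec_mulVec, hx, Matrix.mulVec_zero]
  rw [Matrix.add_mulVec, Matrix.smul_mulVec, hJ, smul_zero, add_zero,
    SimpleGraph.lapMatrix_mulVec_eq_zero_iff_forall_reachable] at hx
  funext i
  have hs : ∑ j, x j = 0 := by simpa [Matrix.mulVec, dotProduct] using congrFun hJ i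
  rw [Finset.sum_congr rfl fun j _ => hx j i (hconn.preconnected j i)] at hs
  simpa using hs

/-- The Moore-Penrose inverse of the Laplacian matrix of a connected graph. -/
lemma exists_pseudoinverse_lapMatrix (hconn : G.Connected) :
    ∃ Y : Matrix V V ℝ, G.lapMatrix ℝ * Y = 1 - (Fintype.card V : ℝ)⁻¹ • allOnes V V ∧
      Y * allOnes V V = 0 ∧ Y.transpose = Y := by
  have := hconn.nonempty
  have hn : (Fintype.card V : ℝ) ≠ 0 := by simp
  set r := (Fintype.card V : ℝ)⁻¹ with hr
  set M := G.lapMatrix ℝ + r • allOnes V V with hM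
  have hMu : IsUnit M.det := (Matrix.isUnit_iff_isUnit_det _).1 (isUnit_lapMatrix_add_allOnes hconn)
  have hMJ : M * allOnes V V = allOnes V V := by
    rw [hM, add_mul, lapMatrix_mul_allOnes, Matrix.smul_mul, allOnes_mul_allOnes,
      inv_smul_smul₀ hn, zero_add]
  have hYJ : (M⁻¹ - r • allOnes V V) * allOnes V V = 0 := by
    have : M⁻¹ * allOnes V V = allOnes V V := by
      conv_lhs => rw [← hMJ]
      exact Matrix.nonsing_inv_mul_cancel_left _ _ hMu
    rw [sub_mul, this, Matrix.smul_mul, allOnes_mul_allOnes, inv_smul_smul₀ hn, sub_self]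
  have hsymm : (M⁻¹ - r • allOnes V V).transpose = M⁻¹ - r • allOnes V V := by
    rw [Matrix.transpose_sub, Matrix.transpose_nonsing_inv, hM, Matrix.transpose_add,
      (G.isSymm_lapMatrix (R := ℝ)).eq, Matrix.transpose_smul, transpose_allOnes]
  refine ⟨M⁻¹ - r • allOnes V V, ?_, hYJ, hsymm⟩
  have hJY : allOnes V V * (M⁻¹ - r • allOnes V V) = 0 := by
    have := congrArg Matrix.transpose hYJ
    rwa [Matrix.transpose_mul, hsymm, transpose_allOnes, Matrix.transpose_zero] at this
  have h1 : M * (M⁻¹ - r • allOnes V V) = 1 - r • allOnes V V := by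
    rw [mul_sub, Matrix.mul_nonsing_inv _ hMu, Matrix.mul_smul, hMJ]
  rwa [hM, add_mul, Matrix.smul_mul, hJY, smul_zero, add_zero] at h1

lemma trace_mul_lapMatrix_mul_nonneg {C : Matrix V V ℝ} (hC : C.transpose = C) :
    0 ≤ (C * G.lapMatrix ℝ * C).trace := by
  have h := ((SimpleGraph.posSemidef_lapMatrix ℝ G).conjTranspose_mul_mul_same C).trace_nonneg
  rwa [Matrix.conjTranspose_eq_transpose_of_trivial, hC] at h

section Regular

variable {d : ℕ} (hreg : G.IsRegularOfDegree d)

include hreg in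
lemma lapMatrix_of_isRegular : G.lapMatrix ℝ = (d : ℝ) • (1 : Matrix V V ℝ) - G.adjMatrix ℝ := by
  rw [SimpleGraph.lapMatrix, SimpleGraph.degMatrix, Matrix.smul_one_eq_diagonal]
  congr 2
  funext v
  rw [hreg v]

include hreg in
lemma trace_adjMatrix_mul_self :
    (G.adjMatrix ℝ * G.adjMatrix ℝ).trace = Fintype.card V * d := by
  simp only [Matrix.trace, Matrix.diag_apply, SimpleGraph.adjMatrix_mul_self_apply_self]
  rw [Finset.sum_congr rfl fun v _ => by rw [hreg v]]
  simp

variable {Y : Matrix V V ℝ}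
  (hY : G.lapMatrix ℝ * Y = 1 - (Fintype.card V : ℝ)⁻¹ • allOnes V V)
  (hYJ : Y * allOnes V V = 0) (hYs : Y.transpose = Y)
include hY hYs

lemma pseudoinverse_mul_lapMatrix :
    Y * G.lapMatrix ℝ = 1 - (Fintype.card V : ℝ)⁻¹ • allOnes V V := by
  have := congrArg Matrix.transpose hY
  rwa [Matrix.transpose_mul, hYs, (G.isSymm_lapMatrix (R := ℝ)).eq, Matrix.transpose_sub,
    Matrix.transpose_one, Matrix.transpose_smul, transpose_allOnes] at this

omit hY hYs in
lemma trace_one_sub_allOnes [Nonempty V] :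
    (1 - (Fintype.card V : ℝ)⁻¹ • allOnes V V).trace = (Fintype.card V : ℝ) - 1 := by
  have : (allOnes V V).trace = (Fintype.card V : ℝ) := by simp [Matrix.trace]
  rw [Matrix.trace_sub, Matrix.trace_one, Matrix.trace_smul, this, smul_eq_mul,
    inv_mul_cancel₀ (by simp)]

include hYJ in
/-- The trace of `C * L * C` for a quadratic polynomial `C` in the Laplacian matrix `L`. -/
lemma trace_polynomial_nonneg [Nonempty V] (a b c : ℝ) :
    0 ≤ a ^ 2 * Y.trace + 2 * a * b * (Fintype.card V - 1)
      + (b ^ 2 + 2 * a * c) * (G.lapMatrix ℝ).trace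
      + 2 * b * c * (G.lapMatrix ℝ * G.lapMatrix ℝ).trace
      + c ^ 2 * (G.lapMatrix ℝ * G.lapMatrix ℝ * G.lapMatrix ℝ).trace := by
  have hLY := hY
  have hYL := pseudoinverse_mul_lapMatrix hY hYs
  set L := G.lapMatrix ℝ with hL
  have hLs : L.transpose = L := G.isSymm_lapMatrix (R := ℝ)
  have htr := trace_one_sub_allOnes (V := V)
  set Q := 1 - (Fintype.card V : ℝ)⁻¹ • allOnes V V with hQ
  have hLQ : L * Q = L := by
    rw [hQ, mul_sub, mul_one, Matrix.mul_smul, lapMatrix_mul_allOnes, smul_zero, sub_zero]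
  have hQL : Q * L = L := by
    rw [hQ, sub_mul, one_mul, Matrix.smul_mul, allOnes_mul_lapMatrix, smul_zero, sub_zero]
  have hYQ : Y * Q = Y := by
    rw [hQ, mul_sub, mul_one, Matrix.mul_smul, hYJ, smul_zero, sub_zero]
  have hQs : Q.transpose = Q := by
    rw [hQ, Matrix.transpose_sub, Matrix.transpose_one, Matrix.transpose_smul, transpose_allOnes]
  have hQY : Q * Y = Y := by
    have := congrArg Matrix.transpose hYQ
    rwa [Matrix.transpose_mul, hYs, hQs] at this
  have hQQ : Q * Q = Q := by
    nth_rw 1 [← hYL]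
    rw [mul_assoc, hLQ, hYL]
  have h := trace_mul_lapMatrix_mul_nonneg (G := G) (C := a • Y + b • Q + c • L) (by
    simp only [Matrix.transpose_add, Matrix.transpose_smul, hYs, hQs, hLs])
  rw [← hL] at h
  -- On an eigenvector of `L` with eigenvalue `λ ≠ 0`, `C` acts as `a/λ + b + cλ`, so the trace is
  -- the sum of `λ (a/λ + b + cλ)²`.
  have hexp : (a • Y + b • Q + c • L) * L * (a • Y + b • Q + c • L)
      = a ^ 2 • Y + (2 * a * b) • Q + (b ^ 2 + 2 * a * c) • L + (2 * b * c) • (L * L)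
        + c ^ 2 • (L * L * L) := by
    simp only [add_mul, mul_add, Matrix.smul_mul, Matrix.mul_smul, hYL, hQL, hQY, hQQ, hLQ,
      mul_assoc, hLY]
    module
  rw [hexp] at h
  simpa [Matrix.trace_add, Matrix.trace_smul, htr] using h

include hYJ hreg

/-- Cauchy–Schwarz for the nonzero eigenvalues, whose sum is `tr L = n d`. The chosen `b` minimizes
the quadratic obtained with `a = 1`, `c = 0`. -/
lemma trace_pseudoinverse_ge (hd : 0 < d) [Nonempty V] :
    ((Fintype.card V : ℝ) - 1) ^ 2 / (Fintype.card V * d) ≤ Y.trace := by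
  have hn : (0 : ℝ) < Fintype.card V := by simp [Fintype.card_pos]
  have hd' : (0 : ℝ) < d := by exact_mod_cast hd
  have h := trace_polynomial_nonneg hY hYJ hYs 1
    (-(((Fintype.card V : ℝ) - 1) / (Fintype.card V * d))) 0
  have ht : (G.lapMatrix ℝ).trace = Fintype.card V * d := by
    rw [lapMatrix_of_isRegular hreg, Matrix.trace_sub, SimpleGraph.trace_adjMatrix, Matrix.trace_smul,
      Matrix.trace_one, smul_eq_mul]
    ring
  rw [ht] at h
  have e : 1 ^ 2 * Y.trace + 2 * 1 * (-(((Fintype.card V : ℝ) - 1) / (Fintype.card V * d)))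
      * (Fintype.card V - 1)
      + ((-(((Fintype.card V : ℝ) - 1) / (Fintype.card V * d))) ^ 2 + 2 * 1 * 0)
        * (Fintype.card V * d) = Y.trace - ((Fintype.card V : ℝ) - 1) ^ 2 / (Fintype.card V * d) := by
    field_simp
    ring
  linarith

end Regular

end Laplacian

/-! ### Cubic graphs on six vertices; recognition of the excluded graphs. -/

section Cubic

variable {V : Type*} [Fintype V] [DecidableEq V] {G : SimpleGraph V} [DecidableRel G.Adj]

lemma trace_pseudoinverse_ge_of_cubic [Nonempty V] (hreg : G.IsRegularOfDegree 3)
    (hcard : Fintype.card V = 6) {Y : Matrix V V ℝ}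
    (hY : G.lapMatrix ℝ * Y = 1 - (Fintype.card V : ℝ)⁻¹ • allOnes V V)
    (hYJ : Y * allOnes V V = 0) (hYs : Y.transpose = Y) :
    3 / 2 + (G.adjMatrix ℝ ^ 3).trace / 324 ≤ Y.trace := by
  -- The summand becomes `(λ - 3)² (λ - 6)² / (9λ)`, which vanishes at 3 and 6, the nonzero
  -- Laplacian eigenvalues of `K₃,₃`.
  have h := trace_polynomial_nonneg hY hYJ hYs 6 (-3) (1 / 3)
  have hA1 := SimpleGraph.trace_adjMatrix ℝ G
  have hA2 := trace_adjMatrix_mul_self hreg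
  have hA3 : (G.adjMatrix ℝ ^ 3) = G.adjMatrix ℝ * G.adjMatrix ℝ * G.adjMatrix ℝ := by
    rw [pow_succ, pow_two]
  rw [lapMatrix_of_isRegular hreg] at h
  rw [hA3]
  rw [hcard] at h hA2
  set A := G.adjMatrix ℝ
  simp only [sub_mul, mul_sub, Matrix.smul_mul, Matrix.mul_smul, one_mul, mul_one,
    Matrix.trace_sub, Matrix.trace_smul, Matrix.trace_one, hA1, hA2, smul_eq_mul, hcard] at h
  push_cast at h
  linarith

lemma trace_adjMatrix_pow_three_pos {u v w : V} (huv : G.Adj u v) (hvw : G.Adj v w)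
    (hwu : G.Adj w u) : 0 < (G.adjMatrix ℝ ^ 3).trace := by
  simp only [Matrix.trace, Matrix.diag_apply, SimpleGraph.adjMatrix_pow_apply_eq_card_walk]
  refine Finset.sum_pos' (fun _ _ => Nat.cast_nonneg _) ⟨u, Finset.mem_univ u, ?_⟩
  rw [Nat.cast_pos, Fintype.card_pos_iff]
  exact ⟨⟨.cons huv (.cons hvw (.cons hwu .nil)), rfl⟩⟩

/-- A triangle-free graph on `2 * d` vertices that is regular of degree `d ≥ 1` is complete
bipartite. -/
lemma nonempty_iso_completeBipartiteGraph {d : ℕ} (hreg : G.IsRegularOfDegree d)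
    (hcard : Fintype.card V = 2 * d) [Nonempty V]
    (htri : ∀ u v w, G.Adj u v → G.Adj v w → ¬ G.Adj w u) :
    Nonempty (G ≃g completeBipartiteGraph (Fin d) (Fin d)) := by
  obtain ⟨v⟩ := ‹Nonempty V›
  have hin : ∀ x, (G.neighborFinset x).card = d := fun x => hreg x
  have hcompl : ((G.neighborFinset v)ᶜ).card = d := by
    rw [Finset.card_compl, hin, hcard]
    omega
  -- Without triangles, a neighbour of `v` has its `d` neighbours outside those of `v`, where only
  -- `d` vertices are left.
  have hN : ∀ a, G.Adj v a → G.neighborFinset a = (G.neighborFinset v)ᶜ := by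
    intro a ha
    refine Finset.eq_of_subset_of_card_le (fun b hb => ?_) (by rw [hin, hcompl])
    rw [SimpleGraph.mem_neighborFinset] at hb
    rw [Finset.mem_compl, SimpleGraph.mem_neighborFinset]
    exact fun hvb => htri v a b ha hb hvb.symm
  have hN' : ∀ b, ¬ G.Adj v b → G.neighborFinset b = G.neighborFinset v := by
    intro b hb
    refine (Finset.eq_of_subset_of_card_le (fun a ha => ?_) (by rw [hin, hin])).symm
    rw [SimpleGraph.mem_neighborFinset] at ha
    rw [SimpleGraph.mem_neighborFinset, SimpleGraph.adj_comm, ← SimpleGraph.mem_neighborFinset,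
      hN a ha]
    simpa using hb
  have hadj : ∀ a, G.Adj v a → ∀ b, (G.Adj a b ↔ ¬ G.Adj v b) := by
    intro a ha b
    rw [← SimpleGraph.mem_neighborFinset, hN a ha]
    simp
  have hadj' : ∀ a, ¬ G.Adj v a → ∀ b, (G.Adj a b ↔ G.Adj v b) := by
    intro a ha b
    rw [← SimpleGraph.mem_neighborFinset, hN' a ha, SimpleGraph.mem_neighborFinset]
  have e₁ : {x // G.Adj v x} ≃ Fin d := Fintype.equivFinOfCardEq (by
    rw [Fintype.card_subtype, ← hin v]
    congr 1
    ext; simp)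
  have e₂ : {x // ¬ G.Adj v x} ≃ Fin d := Fintype.equivFinOfCardEq (by
    rw [Fintype.card_subtype, ← hcompl]
    congr 1
    ext; simp)
  refine ⟨RelIso.symm ⟨(e₁.symm.sumCongr e₂.symm).trans (Equiv.sumCompl (G.Adj v)), ?_⟩⟩
  rintro (a | a) (b | b)
  · simp [hadj _ (e₁.symm a).2, (e₁.symm b).2]
  · simp [hadj _ (e₁.symm a).2, (e₂.symm b).2]
  · simp [hadj' _ (e₂.symm a).2, (e₁.symm b).2]
  · simp [hadj' _ (e₂.symm a).2, (e₂.symm b).2]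

lemma nonempty_iso_completeGraph {d : ℕ} (hreg : G.IsRegularOfDegree d)
    (hcard : Fintype.card V = d + 1) :
    Nonempty (G ≃g SimpleGraph.completeGraph (Fin (d + 1))) := by
  have hN : ∀ v, G.neighborFinset v = Finset.univ.erase v := fun v =>
    Finset.eq_of_subset_of_card_le (fun w hw => Finset.mem_erase.2
      ⟨((G.mem_neighborFinset v w).1 hw).ne', Finset.mem_univ w⟩) (by
        rw [Finset.card_erase_of_mem (Finset.mem_univ v), Finset.card_univ, hcard,
          G.card_neighborFinset_eq_degree, hreg v, Nat.add_sub_cancel])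
  refine ⟨⟨Fintype.equivFinOfCardEq hcard, ?_⟩⟩
  intro a b
  rw [← G.mem_neighborFinset a b, hN]
  simp [SimpleGraph.completeGraph, eq_comm]

end Cubic

/-! ### Generalized inverses and Kemeny's constants of the two walks. -/

section Walks

variable {V : Type*} [Fintype V] [DecidableEq V] {G : SimpleGraph V} [DecidableRel G.Adj]
  {d : ℕ} (hreg : G.IsRegularOfDegree d)
include hreg

lemma edgeTransition_of_isRegular (hd : 3 ≤ d) :
    edgeTransition G = (d : ℝ)⁻¹ • (endIncidence G * startIncidence G) := by
  have hd' : (d : ℝ) ≠ 0 := by positivity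
  have h : edgeDegree G = (d : ℝ) • (1 : Matrix G.Dart G.Dart ℝ) := by
    rw [edgeDegree, Matrix.smul_one_eq_diagonal]
    congr 1
    funext e
    rw [hreg e.snd]
  rw [edgeTransition, h, Matrix.inv_eq_right_inv (B := (d : ℝ)⁻¹ • 1), Matrix.smul_mul, one_mul]
  rw [Matrix.smul_mul, one_mul, smul_inv_smul₀ hd']

lemma nbTransition_of_isRegular (hd : 3 ≤ d) :
    nbTransition G
      = ((d : ℝ) - 1)⁻¹ • (endIncidence G * startIncidence G - edgeReversal G) := by
  have hd' : (d : ℝ) - 1 ≠ 0 := by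
    have : (3 : ℝ) ≤ d := by exact_mod_cast hd
    linarith
  have h : edgeDegree G - 1 = ((d : ℝ) - 1) • (1 : Matrix G.Dart G.Dart ℝ) := by
    rw [edgeDegree, sub_smul, one_smul, Matrix.smul_one_eq_diagonal]
    congr 2
    funext e
    rw [hreg e.snd]
  rw [nbTransition, h, Matrix.inv_eq_right_inv (B := ((d : ℝ) - 1)⁻¹ • 1), Matrix.smul_mul,
    one_mul]
  rw [Matrix.smul_mul, one_mul, smul_inv_smul₀ hd']

omit hreg in
lemma mem_rowStochastic_of_mul_allOnes {α : Type*} [Fintype α] [DecidableEq α] [Nonempty α]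
    {P : Matrix α α ℝ} (h0 : ∀ i j, 0 ≤ P i j) (h : P * allOnes α α = allOnes α α) :
    P ∈ Matrix.rowStochastic ℝ α := by
  obtain ⟨k⟩ := ‹Nonempty α›
  rw [Matrix.mem_rowStochastic_iff_sum]
  exact ⟨h0, fun i => sum_eq_of_mul_allOnes (by rw [h, one_smul]) i k⟩

omit hreg in
lemma one_vecMul_of_allOnes_mul {α : Type*} [Fintype α] [Nonempty α]
    {P : Matrix α α ℝ} (h : allOnes α α * P = allOnes α α) : Matrix.vecMul 1 P = 1 := by
  obtain ⟨k⟩ := ‹Nonempty α›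
  exact congrFun h k

lemma endIncidence_mul_startIncidence_mul_allOnes :
    endIncidence G * startIncidence G * allOnes G.Dart G.Dart
      = (d : ℝ) • allOnes G.Dart G.Dart := by
  rw [Matrix.mul_assoc, startIncidence_mul_allOnes hreg, Matrix.mul_smul,
    endIncidence_mul_allOnes]

lemma allOnes_mul_endIncidence_mul_startIncidence :
    allOnes G.Dart G.Dart * (endIncidence G * startIncidence G)
      = (d : ℝ) • allOnes G.Dart G.Dart := by
  rw [← Matrix.mul_assoc, allOnes_mul_endIncidence hreg, Matrix.smul_mul,
    allOnes_mul_startIncidence]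

omit hreg in
lemma endIncidence_mul_startIncidence_apply (e f : G.Dart) :
    (endIncidence G * startIncidence G) e f = if e.snd = f.fst then 1 else 0 := by
  rw [endIncidence_mul_apply]
  rfl

variable {Y : Matrix V V ℝ}
  (hY : G.lapMatrix ℝ * Y = 1 - (Fintype.card V : ℝ)⁻¹ • allOnes V V)
  (hYJ : Y * allOnes V V = 0)

include hY in
lemma adjMatrix_mul_pseudoinverse :
    G.adjMatrix ℝ * Y = (d : ℝ) • Y - (1 - (Fintype.card V : ℝ)⁻¹ • allOnes V V) := by
  rw [← hY, lapMatrix_of_isRegular hreg, sub_mul, Matrix.smul_mul, one_mul, sub_sub_cancel]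

include hY in
lemma trace_lift [Nonempty V] : (endIncidence G * (Y * startIncidence G)).trace
    = d * Y.trace - (Fintype.card V - 1) := by
  have : (allOnes V V).trace = (Fintype.card V : ℝ) := by simp [Matrix.trace]
  rw [Matrix.trace_mul_comm, Matrix.mul_assoc, startIncidence_mul_endIncidence,
    Matrix.trace_mul_comm, adjMatrix_mul_pseudoinverse hreg hY, Matrix.trace_sub,
    Matrix.trace_sub, Matrix.trace_smul, Matrix.trace_one, Matrix.trace_smul, this, smul_eq_mul,
    smul_eq_mul, inv_mul_cancel₀ (by simp)]

lemma trace_lift_mul_edgeReversal :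
    (endIncidence G * (Y * startIncidence G) * edgeReversal G).trace = d * Y.trace := by
  rw [Matrix.mul_assoc, Matrix.trace_mul_comm, Matrix.mul_assoc, Matrix.mul_assoc,
    startIncidence_mul_edgeReversal_mul_endIncidence hreg, Matrix.mul_smul, mul_one,
    Matrix.trace_smul, smul_eq_mul]

include hYJ in
lemma lift_mul_allOnes :
    endIncidence G * (Y * startIncidence G) * allOnes G.Dart G.Dart = 0 := by
  have hJ : Y * allOnes V G.Dart = 0 := by
    rw [← allOnes_mul_startIncidence (X := V), ← Matrix.mul_assoc, hYJ, Matrix.zero_mul]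
  rw [Matrix.mul_assoc, Matrix.mul_assoc, startIncidence_mul_allOnes hreg, Matrix.mul_smul, hJ,
    smul_zero, Matrix.mul_zero]

include hY in
-- Since `S T = A`, the product is `T (A Y) S`, and `A Y = d Y - (1 - J / n)`.
lemma edge_mul_lift :
    endIncidence G * startIncidence G * (endIncidence G * (Y * startIncidence G))
      = (d : ℝ) • (endIncidence G * (Y * startIncidence G)) - endIncidence G * startIncidence G
        + (Fintype.card V : ℝ)⁻¹ • allOnes G.Dart G.Dart := by
  have h : startIncidence G * (endIncidence G * (Y * startIncidence G))
      = (G.adjMatrix ℝ * Y) * startIncidence G := by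
    rw [← startIncidence_mul_endIncidence]
    simp only [Matrix.mul_assoc]
  rw [Matrix.mul_assoc, h, adjMatrix_mul_pseudoinverse hreg hY]
  simp only [Matrix.sub_mul, Matrix.mul_sub, Matrix.smul_mul, Matrix.mul_smul, Matrix.one_mul,
    allOnes_mul_startIncidence, endIncidence_mul_allOnes]
  abel

lemma edge_mul_edgeReversal_mul_lift :
    endIncidence G * startIncidence G * (edgeReversal G *
      (endIncidence G * (Y * startIncidence G)))
      = (d : ℝ) • (endIncidence G * (Y * startIncidence G)) := by
  have h : startIncidence G * (edgeReversal G * (endIncidence G * (Y * startIncidence G)))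
      = (startIncidence G * (edgeReversal G * endIncidence G)) * (Y * startIncidence G) := by
    simp only [Matrix.mul_assoc]
  rw [Matrix.mul_assoc, h, startIncidence_mul_edgeReversal_mul_endIncidence hreg, Matrix.smul_mul,
    Matrix.one_mul, Matrix.mul_smul]

include hY hYJ

theorem exists_isEdgeKemeny (hd : 3 ≤ d) [Nonempty V] [Nonempty G.Dart] :
    ∃ K : ℝ≥0, IsEdgeKemeny G K ∧
      (K : ℝ) = Fintype.card V * d - Fintype.card V + d * Y.trace := by
  have hd' : (d : ℝ) ≠ 0 := by positivity
  have hP := edgeTransition_of_isRegular hreg hd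
  have hBJ := endIncidence_mul_startIncidence_mul_allOnes hreg
  have hJB := allOnes_mul_endIncidence_mul_startIncidence hreg
  have hBE := edge_mul_lift hreg hY
  have hEJ := lift_mul_allOnes hreg hYJ
  have hE := trace_lift hreg hY
  have hN : (Fintype.card G.Dart : ℝ) = Fintype.card V * d := by
    rw [card_dart_of_isRegular hreg]
    push_cast
    rfl
  have hB0 : ∀ e f, 0 ≤ (endIncidence G * startIncidence G) e f := fun e f => by
    rw [endIncidence_mul_startIncidence_apply]
    split_ifs <;> norm_num
  set B := endIncidence G * startIncidence G
  set E := endIncidence G * (Y * startIncidence G)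
  -- `Z = 1 + E` works because `B E = d E - B + J / n`, so that the terms in `E` and `B` cancel in
  -- `(1 - B / d) (1 + E)`.
  obtain ⟨K, hK, hKv⟩ := exists_isKemenyConstant (P := edgeTransition G) (Z := 1 + E) (c := 1)
    (mem_rowStochastic_of_mul_allOnes (fun e f => by
        rw [hP, Matrix.smul_apply, smul_eq_mul]
        exact mul_nonneg (by positivity) (hB0 e f))
      (by rw [hP, Matrix.smul_mul, hBJ, inv_smul_smul₀ hd']))
    (one_vecMul_of_allOnes_mul (by rw [hP, Matrix.mul_smul, hJB, inv_smul_smul₀ hd']))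
    (by
      rw [hP, sub_mul, one_mul, Matrix.smul_mul, mul_add, mul_one, hBE, hN, mul_inv]
      rw [show B + ((d : ℝ) • E - B + (Fintype.card V : ℝ)⁻¹ • allOnes G.Dart G.Dart)
        = (d : ℝ) • E + (Fintype.card V : ℝ)⁻¹ • allOnes G.Dart G.Dart by abel, smul_add,
        inv_smul_smul₀ hd']
      module)
    (by
      obtain ⟨k⟩ := ‹Nonempty G.Dart›
      exact fun i => sum_eq_of_mul_allOnes (by rw [add_mul, one_mul, hEJ, add_zero, one_smul]) i k)
  refine ⟨K, hK, ?_⟩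
  rw [hKv, Matrix.trace_add, Matrix.trace_one, hN, hE]
  ring

theorem exists_isNonBacktrackingKemeny (hd : 3 ≤ d) [Nonempty V] [Nonempty G.Dart] :
    ∃ K : ℝ≥0, IsNonBacktrackingKemeny G K ∧
      (K : ℝ) = (((d : ℝ) - 1) ^ 2 * (Fintype.card V * d) + ((d : ℝ) - 2) ^ 2 * (d * Y.trace)
        - (((d : ℝ) - 1) ^ 2 + 1) * (Fintype.card V - 1)) / (d * (d - 2))
        - ((d : ℝ) - 1) / d := by
  have hd3 : (3 : ℝ) ≤ d := by exact_mod_cast hd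
  have hd0 : (d : ℝ) ≠ 0 := by positivity
  have hd1 : (d : ℝ) - 1 ≠ 0 := by linarith
  have hd2 : (d : ℝ) - 2 ≠ 0 := by linarith
  have hP := nbTransition_of_isRegular hreg hd
  have hBJ := endIncidence_mul_startIncidence_mul_allOnes hreg
  have hJB := allOnes_mul_endIncidence_mul_startIncidence hreg
  have hBE := edge_mul_lift hreg hY
  have hBRE := edge_mul_edgeReversal_mul_lift (Y := Y) hreg
  have hEJ := lift_mul_allOnes hreg hYJ
  have hE := trace_lift hreg hY
  have hER := trace_lift_mul_edgeReversal (Y := Y) hreg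
  have hRR := edgeReversal_mul_self G
  have hRJ := edgeReversal_mul_allOnes (G := G) (X := G.Dart)
  have hJR := allOnes_mul_edgeReversal (G := G) (X := G.Dart)
  have hR := trace_edgeReversal G
  have hN : (Fintype.card G.Dart : ℝ) = Fintype.card V * d := by
    rw [card_dart_of_isRegular hreg]
    push_cast
    rfl
  have hB0 : ∀ e f, 0 ≤ (endIncidence G * startIncidence G - edgeReversal G) e f := fun e f => by
    rw [Matrix.sub_apply, endIncidence_mul_startIncidence_apply, edgeReversal, Matrix.of_apply]
    split_ifs with h1 h2 <;> simp_all
  set B := endIncidence G * startIncidence G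
  set E := endIncidence G * (Y * startIncidence G)
  set R := edgeReversal G
  set J := allOnes G.Dart G.Dart
  set q : ℝ := (d : ℝ) - 1 with hq
  have hW : (q • 1 - R) * (q • 1 - R) = (q ^ 2 + 1) • 1 - (2 * q) • R := by
    simp only [sub_mul, mul_sub, Matrix.smul_mul, Matrix.mul_smul, one_mul, mul_one, hRR]
    module
  have hWJ : (q • 1 - R) * J = (q - 1) • J := by
    rw [sub_mul, Matrix.smul_mul, one_mul, hRJ]
    module
  have hJW : J * (q • 1 - R) = (q - 1) • J := by
    rw [mul_sub, Matrix.mul_smul, mul_one, hJR]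
    module
  -- As `R² = 1`, `q - R` inverts `q + R` up to the factor `q² - 1 = d (d - 2)`; what remains is a
  -- correction for `B`.
  have hinv : (q • 1 + R - B) * (q • 1 - R) = (q ^ 2 - 1) • 1 - q • B + B * R := by
    simp only [sub_mul, add_mul, mul_sub, Matrix.smul_mul, Matrix.mul_smul, one_mul, mul_one, hRR]
    module
  -- The coefficient of `E` is `q² - 1 - q d + d`, which is zero for `d = q + 1`.
  have hinvE : (q • 1 + R - B) * (q • 1 - R) * E
      = q • B - (q * (Fintype.card V : ℝ)⁻¹) • J := by
    rw [hinv, add_mul, sub_mul, Matrix.smul_mul, Matrix.smul_mul, one_mul, hBE, mul_assoc, hBRE,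
      show (d : ℝ) = q + 1 by rw [hq]; ring]
    module
  -- The error `-q (q B - B R)` from `hinv` cancels against `q B (q - R)` from `hinvE`.
  have hmain : (q • 1 + R - B) * (q • (q • 1 - R) + (q • 1 - R) * E * (q • 1 - R))
      = (q * (q ^ 2 - 1)) • 1 - (q * (Fintype.card V : ℝ)⁻¹ * (q - 1)) • J := by
    rw [mul_add, Matrix.mul_smul, hinv, ← mul_assoc, ← mul_assoc, hinvE, sub_mul, Matrix.smul_mul,
      Matrix.smul_mul, hJW, mul_sub, Matrix.mul_smul, mul_one]
    module
  set k : ℝ := ((d : ℝ) * (d - 2))⁻¹ with hk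
  have hkq : k * (q ^ 2 - 1) = 1 := by
    rw [hk, hq]
    field_simp
    ring
  obtain ⟨K, hK, hKv⟩ := exists_isKemenyConstant (P := nbTransition G)
    (Z := k • (q • (q • 1 - R) + (q • 1 - R) * E * (q • 1 - R))) (c := k * q * (q - 1))
    (mem_rowStochastic_of_mul_allOnes (fun e f => by
        rw [hP, Matrix.smul_apply, smul_eq_mul]
        refine mul_nonneg (inv_nonneg.2 ?_) (hB0 e f)
        rw [hq]
        linarith)
      (by
        rw [hP, Matrix.smul_mul, sub_mul, hBJ, hRJ, inv_smul_eq_iff₀ hd1, hq]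
        module))
    (one_vecMul_of_allOnes_mul (by
      rw [hP, Matrix.mul_smul, mul_sub, hJB, hJR, inv_smul_eq_iff₀ hd1, hq]
      module))
    (by
      have h1 : 1 - nbTransition G = q⁻¹ • (q • 1 + R - B) := by
        rw [hP, eq_inv_smul_iff₀ hd1, smul_sub, smul_inv_smul₀ hd1]
        abel
      rw [h1, Matrix.smul_mul, Matrix.mul_smul, hmain, hN, smul_sub, smul_sub, smul_smul, smul_smul,
        smul_smul, smul_smul]
      congr 1
      · rw [show q⁻¹ * k * (q * (q ^ 2 - 1)) = q⁻¹ * q * (k * (q ^ 2 - 1)) by ring, hkq,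
          inv_mul_cancel₀ hd1, one_mul, one_smul]
      · congr 1
        have hk1 : k * (q - 1) = (d : ℝ)⁻¹ := by
          rw [hk, hq]
          field_simp
          ring
        rw [show q⁻¹ * k * (q * (Fintype.card V : ℝ)⁻¹ * (q - 1))
          = q⁻¹ * q * (k * (q - 1)) * (Fintype.card V : ℝ)⁻¹ by ring, hk1, inv_mul_cancel₀ hd1,
          mul_inv]
        ring)
    (by
      obtain ⟨e⟩ := ‹Nonempty G.Dart›
      refine fun i => sum_eq_of_mul_allOnes ?_ i e
      rw [Matrix.smul_mul, add_mul, Matrix.smul_mul, mul_assoc, hWJ, Matrix.mul_smul, mul_assoc,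
        hEJ, mul_zero, smul_zero, add_zero, smul_smul, smul_smul])
  refine ⟨K, hK, ?_⟩
  rw [hKv, Matrix.trace_smul, Matrix.trace_add, Matrix.trace_smul, mul_assoc,
    Matrix.trace_mul_comm, mul_assoc, hW, mul_sub, Matrix.mul_smul, Matrix.mul_smul, mul_one,
    Matrix.trace_sub, Matrix.trace_sub, Matrix.trace_smul, Matrix.trace_smul, Matrix.trace_smul,
    Matrix.trace_one, hE, hER, hR, hN, hk, hq]
  simp only [smul_eq_mul]
  field_simp
  ring

end Walks

end KemenyNB

/-! ### Comparison of the two constants. -/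

theorem theorem3p3 {V : Type*} [Fintype V] [DecidableEq V] (G : SimpleGraph V)
    [DecidableRel G.Adj] (d : ℕ) (hd : 3 ≤ d) (hconn : G.Connected)
    (hreg : G.IsRegularOfDegree d)
    (hK4 : IsEmpty (G ≃g SimpleGraph.completeGraph (Fin 4)))
    (hK5 : IsEmpty (G ≃g SimpleGraph.completeGraph (Fin 5)))
    (hK33 : IsEmpty (G ≃g completeBipartiteGraph (Fin 3) (Fin 3))) :
    ∃ Ke Knb : ℝ≥0, KemenyNB.IsEdgeKemeny G Ke ∧ KemenyNB.IsNonBacktrackingKemeny G Knb ∧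
      Knb < Ke := by
  have := hconn.nonempty
  have : Nonempty G.Dart := by
    rw [← Fintype.card_pos_iff, KemenyNB.card_dart_of_isRegular hreg]
    exact Nat.mul_pos Fintype.card_pos (by omega)
  obtain ⟨Y, hY, hYJ, hYs⟩ := KemenyNB.exists_pseudoinverse_lapMatrix hconn
  obtain ⟨Ke, hKe, hKe'⟩ := KemenyNB.exists_isEdgeKemeny hreg hY hYJ hd
  obtain ⟨Knb, hKnb, hKnb'⟩ := KemenyNB.exists_isNonBacktrackingKemeny hreg hY hYJ hd
  refine ⟨Ke, Knb, hKe, hKnb, ?_⟩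
  have hd3 : (3 : ℝ) ≤ d := by exact_mod_cast hd
  have hd2 : (0 : ℝ) < d - 2 := by linarith
  have hdiff : (Ke : ℝ) - Knb
      = ((d - 2) * (2 * (d * Y.trace) - Fintype.card V) - d) / (d * (d - 2)) := by
    rw [hKe', hKnb']
    field_simp
    ring
  suffices h : 0 < ((d : ℝ) - 2) * (2 * (d * Y.trace) - Fintype.card V) - d by
    rw [← NNReal.coe_lt_coe, ← sub_pos, hdiff]
    positivity
  have hlt : d < Fintype.card V := by
    obtain ⟨v⟩ := ‹Nonempty V›
    rw [← hreg v]
    exact G.degree_lt_card_verts v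
  by_cases h36 : d = 3 ∧ Fintype.card V = 6
  · obtain ⟨rfl, h6⟩ := h36
    have htri : ∃ u v w, G.Adj u v ∧ G.Adj v w ∧ G.Adj w u := by
      by_contra! hno
      exact hK33.false (KemenyNB.nonempty_iso_completeBipartiteGraph hreg h6 hno).some
    obtain ⟨u, v, w, huv, hvw, hwu⟩ := htri
    have h1 := KemenyNB.trace_adjMatrix_pow_three_pos huv hvw hwu
    have h2 := KemenyNB.trace_pseudoinverse_ge_of_cubic hreg h6 hY hYJ hYs
    rw [h6]
    push_cast
    linarith
  have h4 : ¬ (d = 3 ∧ Fintype.card V = 4) := by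
    rintro ⟨rfl, h⟩
    exact hK4.false (KemenyNB.nonempty_iso_completeGraph hreg h).some
  have h5 : ¬ (d = 4 ∧ Fintype.card V = 5) := by
    rintro ⟨rfl, h⟩
    exact hK5.false (KemenyNB.nonempty_iso_completeGraph hreg h).some
  -- Parity: `3 * 5` oriented edges cannot be twice a number of edges.
  have hpar : ¬ (d = 3 ∧ Fintype.card V = 5) := by
    rintro ⟨rfl, h⟩
    have h1 := KemenyNB.card_dart_of_isRegular hreg
    rw [G.dart_card_eq_twice_card_edges, h] at h1
    omega
  have hn : (0 : ℝ) < Fintype.card V := by simp [Fintype.card_pos]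
  have hb := KemenyNB.trace_pseudoinverse_ge hreg hY hYJ hYs (by omega)
  rw [div_le_iff₀ (by positivity)] at hb
  have hcases : (d = 3 ∧ 7 ≤ Fintype.card V) ∨ (4 ≤ d ∧ 6 ≤ Fintype.card V) := by omega
  set n : ℝ := (Fintype.card V : ℝ) with hndef
  have hb' : 2 * (n - 1) ^ 2 / n ≤ 2 * (d * Y.trace) := by
    rw [div_le_iff₀ hn]
    linarith
  have hkey : 0 < (d - 2) * (n - 4) - (d : ℝ) + 2 * (d - 2) / n := by
    -- This term gives strictness: the rest is nonnegative in both cases but vanishes at `(d, n) =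
    -- (3, 7)` and `(4, 6)`.
    have hpos : 0 < 2 * ((d : ℝ) - 2) / n := by positivity
    rcases hcases with ⟨h1, h2⟩ | ⟨h1, h2⟩
    · have h2' : (7 : ℝ) ≤ n := by rw [hndef]; exact_mod_cast h2
      rw [h1] at hpos ⊢
      push_cast at hpos ⊢
      linarith
    · have h1' : (4 : ℝ) ≤ d := by exact_mod_cast h1
      have h2' : (6 : ℝ) ≤ n := by rw [hndef]; exact_mod_cast h2
      nlinarith
  have hexp : ((d : ℝ) - 2) * (2 * (n - 1) ^ 2 / n - n) - d
      = (d - 2) * (n - 4) - (d : ℝ) + 2 * (d - 2) / n := by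
    field_simp
    ring
  have := mul_le_mul_of_nonneg_left hb' hd2.le
  linarith
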